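/- Let $N\ge 1$, let $0\le\alpha\le 1$ and let $R,Q$ be column-stochastic $N\times N$ matrices (nonnegative entries, columns summing to $1$). A second-order retrospective higher-order Markov process (RHOMP) with parameters $\alpha,R,Q$ is a process $X_1,X_2,\dots$ on $\{1,\dots,N\}$, with an arbitrary joint law of $(X_1,X_2)$, such that for all $t\ge 3$ $$\Pr\big(X_t=i\mid X_{t-1}=j,\,X_{t-2}=k,\,X_{t-3}=i_{t-3},\dots,X_1=i_1\big)=\alpha R_{i,j}+(1-\alpha)Q_{i,k}$$ whenever the event conditioned on has positive probability. Put $P=\alpha R+(1-\alpha)Q$. Then: (1) For every joint law of $(X_1,X_2)$ such a process exists. For every such process, almost surely, the long-run fractions of time $$x_i=\lim_{t\to\infty}\frac{\#\{s\le t: X_s=i\}}{t},\qquad Y_{j,k}=\lim_{t\to\infty}\frac{\#\{s\le t: X_{s+1}=j,\ X_s=k\}}{t}$$ exist for all states $i,j,k$ (they may depend on the initial law and on the trajectory). They are probability distributions on the states and on the pairs of states, $Y$ is stationary for the first-order chain of pairs, i.e. $Y_{i,j}=\sum_k(\alpha R_{i,j}+(1-\alpha)Q_{i,k})Y_{j,k}$,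 both marginals of $Y$ are equal to $x$, i.e. $x_i=\sum_j Y_{i,j}=\sum_j Y_{j,i}$, and $x=Px$. (2) If $P$ is irreducible, then the limiting distribution $x$ is unique: there is one probability vector $x$, the only one with $x=Px$, such that for every process with the parameters $\alpha,R,Q$, whatever the law of $(X_1,X_2)$, almost surely $\#\{s\le t: X_s=i\}/t\to x_i$ for every $i$. -/

import Mathlib

open MeasureTheory Filter Topology

noncomputable section

/-- The parameters `α, R, Q` of a second-order retrospective higher-order Markov process (RHOMP)
on the states `Fin N`.  Matrices act on column vectors: `R i j` is the probability to move from
`j` to `i`, so the columns of a stochastic matrix sum to one. -/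
structure RHOMPModel (N : ℕ) where
  /-- the probability that the current state is selected from the history -/
  α : ℝ
  /-- the transitions from the current state, when that one is selected -/
  R : Matrix (Fin N) (Fin N) ℝ
  /-- the transitions from the previous state, when that one is selected -/
  Q : Matrix (Fin N) (Fin N) ℝ
  α_nonneg : 0 ≤ α
  α_le_one : α ≤ 1
  R_stochastic : R ∈ Matrix.colStochastic ℝ (Fin N)
  Q_stochastic : Q ∈ Matrix.colStochastic ℝ (Fin N)

namespace RHOMPModel

variable {N : ℕ}

/-- The probability to move to `i` from the current state `j` with previous state `k`. -/
def trans (M : RHOMPModel N) (i j k : Fin N) : ℝ :=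
  M.α * M.R i j + (1 - M.α) * M.Q i k

/-- The matrix `αR + (1 - α)Q`. -/
def mix (M : RHOMPModel N) : Matrix (Fin N) (Fin N) ℝ :=
  M.α • M.R + (1 - M.α) • M.Q

/-- `X 0, X 1, X 2, …` is a RHOMP with the parameters `M` under the law `μ`, with an arbitrary joint
law of `(X 0, X 1)`: conditionally on the whole history `X 0 = a 0, …, X (n + 1) = a (n + 1)`, the
probability of `X (n + 2) = a (n + 2)` is `M.trans (a (n + 2)) (a (n + 1)) (a n)`.  The conditional
probability is multiplied out, so that nothing is required after a history of probability zero. -/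
structure IsRHOMP (M : RHOMPModel N) {Ω : Type*} [MeasurableSpace Ω] (μ : Measure Ω)
    (X : ℕ → Ω → Fin N) : Prop where
  measurable : ∀ t, Measurable (X t)
  transition : ∀ (a : ℕ → Fin N) (n : ℕ),
    μ.real {ω | ∀ s ≤ n + 2, X s ω = a s} =
      μ.real {ω | ∀ s ≤ n + 1, X s ω = a s} * M.trans (a (n + 2)) (a (n + 1)) (a n)

end RHOMPModel

/-- The fraction of the first `t` time steps at which the trajectory `u` is in the state `i`. -/
def visitFraction {S : Type*} [DecidableEq S] (u : ℕ → S) (i : S) (t : ℕ) : ℝ :=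
  (((Finset.range t).filter fun s => u s = i).card : ℝ) / (t : ℝ)

end

/-!
The pairs `(X (t + 1), X t)` form a first-order Markov chain on a finite set, so the almost sure
limits come from an ergodic theorem for a column-stochastic matrix `P` that may be reducible.
Since `f ↦ f ᵥ* P` has bounded orbits, every `f` splits as `h + (g - g ᵥ* P)` with `h ᵥ* P = h`.
Along a trajectory `h (Z n)` is a bounded martingale and converges. Up to a telescoping sum, the
averages of `g - g ᵥ* P` are averages of bounded martingale differences, which tend to zero by
orthogonality in `L²` and Kronecker's lemma. For the indicators `g` this also says that the
limiting frequencies are stationary, and the marginals of the pair frequencies differ only by a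
shift in time.

For uniqueness, let `x` and `y` be stationary distributions of an irreducible matrix. Then `y` is
positive, and with `c = min (x i / y i)` the vector `x - c • y` is nonnegative, stationary and zero
somewhere, hence zero.
-/

section MeanErgodic

variable {𝕜 E : Type*} [RCLike 𝕜] [NormedAddCommGroup E] [NormedSpace 𝕜 E]

theorem disjoint_ker_range_id_sub {T : E →ₗ[𝕜] E}
    (hT : ∀ f, Bornology.IsBounded (Set.range fun n => T^[n] f)) :
    Disjoint (LinearMap.ker (LinearMap.id - T)) (LinearMap.range (LinearMap.id - T)) := by
  rw [Submodule.disjoint_def]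
  rintro h hker ⟨g, rfl⟩
  have hfix : Function.IsFixedPt T (g - T g) := (sub_eq_zero.1 hker).symm
  have hzero := (tendsto_birkhoffAverage_apply_sub_birkhoffAverage 𝕜 (g := id) (hT g)).neg
  rw [neg_zero] at hzero
  have hconst := hfix.tendsto_birkhoffAverage 𝕜 (id : E → E)
  refine tendsto_nhds_unique hconst (hzero.congr fun n => ?_)
  simp only [birkhoffAverage, birkhoffSum, id_eq, iterate_map_sub, Finset.sum_sub_distrib,
    ← smul_sub]
  rw [← smul_neg, neg_sub]

theorem exists_fixed_add_coboundary [FiniteDimensional 𝕜 E] {T : E →ₗ[𝕜] E}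
    (hT : ∀ f, Bornology.IsBounded (Set.range fun n => T^[n] f)) (f : E) :
    ∃ h g, T h = h ∧ f = h + (g - T g) := by
  have hcompl : IsCompl (LinearMap.ker (LinearMap.id - T)) (LinearMap.range (LinearMap.id - T)) :=
    (Submodule.isCompl_iff_disjoint _ _
      (by rw [add_comm, LinearMap.finrank_range_add_finrank_ker])).2 (disjoint_ker_range_id_sub hT)
  obtain ⟨h, hh, _, ⟨g, rfl⟩, hfg⟩ := Submodule.mem_sup.1 (hcompl.sup_eq_top ▸ Submodule.mem_top)
  exact ⟨h, g, (sub_eq_zero.1 hh).symm, hfg.symm⟩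

end MeanErgodic

section Average

-- Kronecker's lemma; summation by parts writes the average as a sequence minus its Cesàro mean.
theorem tendsto_average_of_tendsto_sum_div {a : ℕ → ℝ} {s : ℝ}
    (h : Tendsto (fun n : ℕ => ∑ k ∈ Finset.range n, a k / (k + 1)) atTop (𝓝 s)) :
    Tendsto (fun n : ℕ => (n : ℝ)⁻¹ * ∑ k ∈ Finset.range n, a k) atTop (𝓝 0) := by
  set b : ℕ → ℝ := fun n => ∑ k ∈ Finset.range n, a k / (k + 1)
  have hparts (n : ℕ) :
      ∑ k ∈ Finset.range n, a k = n * b n - ∑ k ∈ Finset.range n, b k := by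
    induction n with
    | zero => simp
    | succ n ih =>
      have hb : b (n + 1) = b n + a n / (n + 1) := Finset.sum_range_succ _ _
      have hn : (n : ℝ) + 1 ≠ 0 := by positivity
      rw [Finset.sum_range_succ, Finset.sum_range_succ, ih, hb]
      push_cast
      field_simp
      ring
  have hlim := h.sub h.cesaro
  rw [sub_self] at hlim
  refine hlim.congr' ?_
  filter_upwards [eventually_ne_atTop 0] with n hn
  rw [hparts]
  field_simp

theorem tendsto_average_sub_succ {a : ℕ → ℝ} {C : ℝ} (ha : ∀ n, |a n| ≤ C) :
    Tendsto (fun n : ℕ => (n : ℝ)⁻¹ * ∑ k ∈ Finset.range n, (a k - a (k + 1))) atTop (𝓝 0) := by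
  have hbound : Tendsto (fun n : ℕ => (n : ℝ)⁻¹ * (C + C)) atTop (𝓝 0) := by
    simpa using tendsto_inv_atTop_nhds_zero_nat.mul_const (C + C)
  refine squeeze_zero_norm (fun n => ?_) hbound
  rw [Finset.sum_range_sub', norm_mul, norm_inv, Real.norm_natCast]
  gcongr
  exact (abs_sub _ _).trans (add_le_add (ha 0) (ha n))

end Average

/-- A sequence of martingale differences for the filtration `ℱ`; `D n` is the increment between the
times `n` and `n + 1`. -/
structure IsMartingaleDifference {Ω : Type*} {m0 : MeasurableSpace Ω} (D : ℕ → Ω → ℝ)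
    (ℱ : Filtration ℕ m0) (μ : Measure Ω) : Prop where
  stronglyMeasurable : ∀ n, StronglyMeasurable[ℱ (n + 1)] (D n)
  integrable : ∀ n, Integrable (D n) μ
  condExp_eq_zero : ∀ n, μ[D n | ℱ n] =ᵐ[μ] 0

theorem IsMartingaleDifference.const_mul {Ω : Type*} {m0 : MeasurableSpace Ω} {μ : Measure Ω}
    {ℱ : Filtration ℕ m0} {D : ℕ → Ω → ℝ} (hD : IsMartingaleDifference D ℱ μ) (c : ℕ → ℝ) :
    IsMartingaleDifference (fun n ω => c n * D n ω) ℱ μ where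
  stronglyMeasurable n := (hD.stronglyMeasurable n).const_mul (c n)
  integrable n := (hD.integrable n).const_mul (c n)
  condExp_eq_zero n := by
    refine (condExp_smul (c n) (D n) (ℱ n)).trans ?_
    filter_upwards [hD.condExp_eq_zero n] with ω hω
    simp [hω]

section MartingaleDifference

variable {Ω : Type*} {m0 : MeasurableSpace Ω} {μ : Measure Ω} [IsFiniteMeasure μ]

theorem eLpNorm_one_le_of_integral_sq_le {f : Ω → ℝ} (hf : MemLp f 2 μ) {K : ℝ}
    (hK : ∫ ω, f ω ^ 2 ∂μ ≤ K) : eLpNorm f 1 μ ≤ ENNReal.ofReal (μ.real Set.univ + K) := by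
  have hle (ω : Ω) : ‖f ω‖ ≤ 1 + f ω ^ 2 := by
    rw [Real.norm_eq_abs, ← sq_abs (f ω)]
    nlinarith [sq_nonneg (|f ω| - 1)]
  have hint : Integrable f μ := hf.integrable one_le_two
  rw [eLpNorm_one_eq_lintegral_enorm, ← ofReal_integral_norm_eq_lintegral_enorm hint]
  apply ENNReal.ofReal_le_ofReal
  calc ∫ ω, ‖f ω‖ ∂μ ≤ ∫ ω, (1 + f ω ^ 2) ∂μ :=
        integral_mono hint.norm ((integrable_const _).add hf.integrable_sq) hle
    _ = μ.real Set.univ + ∫ ω, f ω ^ 2 ∂μ := by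
        rw [integral_add (integrable_const _) hf.integrable_sq]
        simp
    _ ≤ μ.real Set.univ + K := by gcongr

namespace IsMartingaleDifference

variable {ℱ : Filtration ℕ m0} {D : ℕ → Ω → ℝ}

theorem martingale_sum (hD : IsMartingaleDifference D ℱ μ) :
    Martingale (fun n ω => ∑ k ∈ Finset.range n, D k ω) ℱ μ := by
  refine martingale_of_condExp_sub_eq_zero_nat
    (fun n => Finset.stronglyMeasurable_fun_sum _ fun k hk =>
      (hD.stronglyMeasurable k).mono (ℱ.mono (Finset.mem_range.1 hk)))
    (fun n => integrable_finsetSum _ fun k _ => hD.integrable k) fun n => ?_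
  convert hD.condExp_eq_zero n using 2
  ext ω
  simp [Finset.sum_range_succ]

theorem integral_sum_mul_eq_zero (hD : IsMartingaleDifference D ℱ μ) (hL2 : ∀ n, MemLp (D n) 2 μ)
    (n : ℕ) : ∫ ω, (∑ k ∈ Finset.range n, D k ω) * D n ω ∂μ = 0 := by
  set S : Ω → ℝ := fun ω => ∑ k ∈ Finset.range n, D k ω
  have hS : MemLp S 2 μ := memLp_finsetSum _ fun k _ => hL2 k
  have hpull : μ[S * D n | ℱ n] =ᵐ[μ] S * μ[D n | ℱ n] :=
    condExp_mul_of_stronglyMeasurable_left (hD.martingale_sum.stronglyAdapted n)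
      (hS.integrable_mul (hL2 n)) (hD.integrable n)
  calc ∫ ω, S ω * D n ω ∂μ = ∫ ω, (μ[S * D n | ℱ n]) ω ∂μ := (integral_condExp (ℱ.le n)).symm
    _ = ∫ _, 0 ∂μ := by
        refine integral_congr_ae ?_
        filter_upwards [hpull, hD.condExp_eq_zero n] with ω hω hzero
        simp [hω, hzero]
    _ = 0 := integral_zero _ _

theorem integral_sum_sq (hD : IsMartingaleDifference D ℱ μ) (hL2 : ∀ n, MemLp (D n) 2 μ) (n : ℕ) :
    ∫ ω, (∑ k ∈ Finset.range n, D k ω) ^ 2 ∂μ = ∑ k ∈ Finset.range n, ∫ ω, D k ω ^ 2 ∂μ := by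
  induction n with
  | zero => simp
  | succ n ih =>
    have hS : MemLp (fun ω => ∑ k ∈ Finset.range n, D k ω) 2 μ := memLp_finsetSum _ fun k _ => hL2 k
    have hcross : Integrable (fun ω => 2 * ((∑ k ∈ Finset.range n, D k ω) * D n ω)) μ :=
      (hS.integrable_mul (hL2 n)).const_mul 2
    have hleft : Integrable (fun ω => (∑ k ∈ Finset.range n, D k ω) ^ 2 +
        2 * ((∑ k ∈ Finset.range n, D k ω) * D n ω)) μ := hS.integrable_sq.add hcross
    simp_rw [Finset.sum_range_succ, add_sq, mul_assoc]
    rw [integral_add hleft (hL2 n).integrable_sq,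
      integral_add hS.integrable_sq hcross, integral_const_mul,
      hD.integral_sum_mul_eq_zero hL2, ih, mul_zero, add_zero]

theorem ae_exists_tendsto_sum (hD : IsMartingaleDifference D ℱ μ) (hL2 : ∀ n, MemLp (D n) 2 μ)
    (hsum : Summable fun n => ∫ ω, D n ω ^ 2 ∂μ) :
    ∀ᵐ ω ∂μ, ∃ c, Tendsto (fun n => ∑ k ∈ Finset.range n, D k ω) atTop (𝓝 c) := by
  refine hD.martingale_sum.submartingale.exists_ae_tendsto_of_bdd
    (R := (μ.real Set.univ + ∑' k, ∫ ω, D k ω ^ 2 ∂μ).toNNReal) fun n => ?_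
  refine eLpNorm_one_le_of_integral_sq_le (memLp_finsetSum _ fun k _ => hL2 k) ?_
  rw [hD.integral_sum_sq hL2]
  exact hsum.sum_le_tsum _ fun k _ => integral_nonneg fun ω => sq_nonneg _

theorem ae_tendsto_average_of_summable (hD : IsMartingaleDifference D ℱ μ)
    (hL2 : ∀ n, MemLp (D n) 2 μ)
    (hsum : Summable fun n : ℕ => (∫ ω, D n ω ^ 2 ∂μ) / ((n : ℝ) + 1) ^ 2) :
    ∀ᵐ ω ∂μ, Tendsto (fun n : ℕ => (n : ℝ)⁻¹ * ∑ k ∈ Finset.range n, D k ω) atTop (𝓝 0) := by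
  have hconv := (hD.const_mul fun n => ((n : ℝ) + 1)⁻¹).ae_exists_tendsto_sum
    (fun n => (hL2 n).const_mul _)
    (by simpa only [mul_pow, integral_const_mul, inv_pow, div_eq_inv_mul] using hsum)
  filter_upwards [hconv] with ω ⟨s, hs⟩
  exact tendsto_average_of_tendsto_sum_div (by simpa only [div_eq_inv_mul] using hs)

theorem ae_tendsto_average_of_bounded (hD : IsMartingaleDifference D ℱ μ) {C : ℝ}
    (hC : ∀ n ω, |D n ω| ≤ C) :
    ∀ᵐ ω ∂μ, Tendsto (fun n : ℕ => (n : ℝ)⁻¹ * ∑ k ∈ Finset.range n, D k ω) atTop (𝓝 0) := by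
  have hL2 (n : ℕ) : MemLp (D n) 2 μ :=
    MemLp.of_bound (hD.integrable n).aestronglyMeasurable C (ae_of_all _ (hC n))
  refine hD.ae_tendsto_average_of_summable hL2 ?_
  have hvar (n : ℕ) : ∫ ω, D n ω ^ 2 ∂μ ≤ μ.real Set.univ * C ^ 2 :=
    calc ∫ ω, D n ω ^ 2 ∂μ ≤ ∫ _, C ^ 2 ∂μ :=
          integral_mono (hL2 n).integrable_sq (integrable_const _) fun ω =>
            sq_le_sq' (abs_le.1 (hC n ω)).1 (abs_le.1 (hC n ω)).2
      _ = μ.real Set.univ * C ^ 2 := by rw [integral_const, smul_eq_mul]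
  have hinv : Summable fun n : ℕ => 1 / ((n : ℝ) + 1) ^ 2 := by
    simpa using (summable_nat_add_iff 1).2 (Real.summable_one_div_nat_pow.2 one_lt_two)
  refine (hinv.mul_left (μ.real Set.univ * C ^ 2)).of_nonneg_of_le
    (fun n => div_nonneg (integral_nonneg fun ω => sq_nonneg _) (sq_nonneg _)) fun n => ?_
  rw [mul_one_div]
  gcongr
  exact hvar n

end IsMartingaleDifference

end MartingaleDifference

section VisitFraction

variable {S : Type*} [DecidableEq S]

theorem visitFraction_eq_average (u : ℕ → S) (i : S) (t : ℕ) :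
    visitFraction u i t = (t : ℝ)⁻¹ * ∑ s ∈ Finset.range t, if u s = i then 1 else 0 := by
  rw [visitFraction, Finset.sum_boole, div_eq_inv_mul]

theorem visitFraction_nonneg (u : ℕ → S) (i : S) (t : ℕ) : 0 ≤ visitFraction u i t := by
  unfold visitFraction
  positivity

theorem average_eq_sum_visitFraction [Fintype S] (u : ℕ → S) (g : S → ℝ) (t : ℕ) :
    (t : ℝ)⁻¹ * ∑ s ∈ Finset.range t, g (u s) = ∑ i, g i * visitFraction u i t := by
  simp only [visitFraction_eq_average, Finset.mul_sum]
  rw [Finset.sum_comm]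
  exact Finset.sum_congr rfl fun s _ => by simp [mul_comm]

theorem sum_visitFraction [Fintype S] (u : ℕ → S) {t : ℕ} (ht : t ≠ 0) :
    ∑ i, visitFraction u i t = 1 := by
  simpa [ht] using (average_eq_sum_visitFraction u (fun _ => 1) t).symm

theorem mem_stdSimplex_of_tendsto_visitFraction [Fintype S] {u : ℕ → S} {y : S → ℝ}
    (h : ∀ i, Tendsto (visitFraction u i) atTop (𝓝 (y i))) : y ∈ stdSimplex ℝ S := by
  refine ⟨fun i => ge_of_tendsto' (h i) (visitFraction_nonneg u i), ?_⟩
  refine tendsto_nhds_unique (tendsto_finsetSum _ fun i _ => h i) (tendsto_const_nhds.congr' ?_)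
  filter_upwards [eventually_ne_atTop 0] with t ht
  exact (sum_visitFraction u ht).symm

theorem tendsto_visitFraction_sub_shift (u : ℕ → S) (i : S) :
    Tendsto (fun t => visitFraction u i t - visitFraction (fun s => u (s + 1)) i t) atTop
      (𝓝 0) := by
  refine (tendsto_average_sub_succ (a := fun s => if u s = i then 1 else 0) (C := 1)
    fun s => by split_ifs <;> simp).congr fun t => ?_
  simp only [visitFraction_eq_average, ← mul_sub, Finset.sum_sub_distrib]

variable {A B : Type*} [DecidableEq A] [DecidableEq B]

theorem visitFraction_fst_eq_sum [Fintype B] (u : ℕ → A × B) (a : A) (t : ℕ) :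
    visitFraction (fun s => (u s).1) a t = ∑ b, visitFraction u (a, b) t := by
  simp only [visitFraction_eq_average, ← Finset.mul_sum]
  rw [Finset.sum_comm]
  simp [Prod.ext_iff, ite_and]

theorem visitFraction_snd_eq_sum [Fintype A] (u : ℕ → A × B) (b : B) (t : ℕ) :
    visitFraction (fun s => (u s).2) b t = ∑ a, visitFraction u (a, b) t := by
  simp only [visitFraction_eq_average, ← Finset.mul_sum]
  rw [Finset.sum_comm]
  simp [Prod.ext_iff, ite_and]

end VisitFraction

section ConditionalExpectation

variable {Ω : Type*} {m0 : MeasurableSpace Ω} {μ : Measure Ω} [IsFiniteMeasure μ]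

theorem setIntegral_comp_of_fintype {S : Type*} [Fintype S] [MeasurableSpace S]
    [MeasurableSingletonClass S] {Y : Ω → S} (hY : Measurable Y) (φ : S → ℝ) (A : Set Ω) :
    ∫ ω in A, φ (Y ω) ∂μ = ∑ i, μ.real (Y ⁻¹' {i} ∩ A) * φ i := by
  rw [← integral_map (φ := Y) hY.aemeasurable (measurable_of_finite φ).aestronglyMeasurable,
    integral_fintype Integrable.of_finite]
  refine Finset.sum_congr rfl fun i _ => ?_
  rw [map_measureReal_apply hY (measurableSet_singleton i),
    measureReal_restrict_apply (hY (measurableSet_singleton i)), smul_eq_mul]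

theorem condExp_comap_of_setIntegral_fiber {A : Type*} [Finite A] [MeasurableSpace A]
    [MeasurableSingletonClass A] {H : Ω → A} (hH : Measurable H) {f : Ω → ℝ} (hf : Integrable f μ)
    {φ : A → ℝ} (hφ : ∀ a, ∫ ω in H ⁻¹' {a}, f ω ∂μ = μ.real (H ⁻¹' {a}) * φ a) :
    μ[f | MeasurableSpace.comap H inferInstance] =ᵐ[μ] fun ω => φ (H ω) := by
  have hφm : Measurable φ := measurable_of_finite φ
  have hφint : Integrable (fun ω => φ (H ω)) μ :=
    (Integrable.of_finite (μ := μ.map H)).comp_measurable hH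
  refine (ae_eq_condExp_of_forall_setIntegral_eq hH.comap_le hf (fun _ _ _ => hφint.integrableOn)
    ?_ (hφm.comp (comap_measurable H)).aestronglyMeasurable).symm
  rintro _ ⟨B, -, rfl⟩ -
  have hfin := B.toFinite
  have hfibers : H ⁻¹' B = ⋃ a ∈ hfin.toFinset, H ⁻¹' {a} := by ext; simp
  have hmeas : ∀ a ∈ hfin.toFinset, MeasurableSet (H ⁻¹' {a}) := fun a _ =>
    hH (measurableSet_singleton a)
  have hdisj : Set.Pairwise (↑hfin.toFinset) (Function.onFun Disjoint fun a => H ⁻¹' {a}) :=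
    fun a _ b _ hab => Disjoint.preimage _ (by simpa using hab)
  rw [hfibers, integral_biUnion_finset _ hmeas hdisj fun _ _ => hφint.integrableOn,
    integral_biUnion_finset _ hmeas hdisj fun _ _ => hf.integrableOn]
  refine Finset.sum_congr rfl fun a ha => ?_
  rw [hφ, setIntegral_congr_fun (hmeas a ha) (g := fun _ => φ a) fun ω hω => congrArg φ hω,
    setIntegral_const, smul_eq_mul]

end ConditionalExpectation

/-- `Z 0, Z 1, …` is a Markov chain with the transition matrix `P` under the law `μ`, with an
arbitrary law of `Z 0`: conditionally on the history `Z 0 = a 0, …, Z n = a n`, the probability of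
`Z (n + 1) = a (n + 1)` is `P (a (n + 1)) (a n)`.  As in `RHOMPModel.IsRHOMP`, the columns of `P`
are the transition laws and the conditional probability is multiplied out. -/
structure IsMarkovChain {Ω S : Type*} [MeasurableSpace Ω] [MeasurableSpace S] (P : Matrix S S ℝ)
    (μ : Measure Ω) (Z : ℕ → Ω → S) : Prop where
  measurable : ∀ t, Measurable (Z t)
  transition : ∀ (a : ℕ → S) (n : ℕ),
    μ.real {ω | ∀ s ≤ n + 1, Z s ω = a s} =
      μ.real {ω | ∀ s ≤ n, Z s ω = a s} * P (a (n + 1)) (a n)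

/-- The filtration whose `n`-th σ-algebra is generated by `Z 0, …, Z n`.  The history is bundled as
a random variable with values in a finite type, so that its fibers generate the σ-algebra. -/
def historyFiltration {Ω S : Type*} {m0 : MeasurableSpace Ω} [MeasurableSpace S] {Z : ℕ → Ω → S}
    (hZ : ∀ t, Measurable (Z t)) : Filtration ℕ m0 where
  seq n := MeasurableSpace.comap (fun ω (s : Finset.Iic n) => Z s ω) inferInstance
  mono' n m hnm := by
    have hrestrict : Measurable
        (Finset.restrict₂ (π := fun _ : ℕ => S) (Finset.Iic_subset_Iic.2 hnm)) :=
      Finset.measurable_restrict₂ _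
    exact (MeasurableSpace.comap_mono hrestrict.comap_le).trans_eq' MeasurableSpace.comap_comp
  le' n := (measurable_pi_lambda (fun ω (s : Finset.Iic n) => Z s ω) fun s => hZ s).comap_le

theorem norm_vecMul_le_of_mem_colStochastic {S : Type*} [Fintype S] [DecidableEq S]
    {P : Matrix S S ℝ} (hP : P ∈ Matrix.colStochastic ℝ S) (f : S → ℝ) :
    ‖Matrix.vecMul f P‖ ≤ ‖f‖ := by
  refine (pi_norm_le_iff_of_nonneg (norm_nonneg f)).2 fun j => ?_
  calc ‖∑ i, f i * P i j‖ ≤ ∑ i, ‖f‖ * P i j := by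
        refine norm_sum_le_of_le _ fun i _ => ?_
        have hnonneg := Matrix.nonneg_of_mem_colStochastic hP (i := i) (j := j)
        rw [norm_mul, Real.norm_of_nonneg hnonneg]
        exact mul_le_mul_of_nonneg_right (norm_le_pi_norm f i) hnonneg
    _ = ‖f‖ := by rw [← Finset.mul_sum, Matrix.sum_col_of_mem_colStochastic hP, mul_one]

section MarkovChain

variable {Ω S : Type*} {m0 : MeasurableSpace Ω} {μ : Measure Ω} [MeasurableSpace S]
  {P : Matrix S S ℝ} {Z : ℕ → Ω → S}

namespace IsMarkovChain

theorem measureReal_preimage_inter_cylinder (h : IsMarkovChain P μ Z) (a : ℕ → S) (n : ℕ) (i : S) :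
    μ.real (Z (n + 1) ⁻¹' {i} ∩ {ω | ∀ s ≤ n, Z s ω = a s}) =
      μ.real {ω | ∀ s ≤ n, Z s ω = a s} * P i (a n) := by
  classical
  have hold (s : ℕ) (hs : s ≤ n) : Function.update a (n + 1) i s = a s :=
    Function.update_of_ne (by lia) _ _
  have hlong : {ω | ∀ s ≤ n + 1, Z s ω = Function.update a (n + 1) i s} =
      Z (n + 1) ⁻¹' {i} ∩ {ω | ∀ s ≤ n, Z s ω = a s} := by
    ext ω
    simp +contextual [Nat.le_add_one_iff, or_imp, forall_and, hold, and_comm]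
  have hshort : {ω | ∀ s ≤ n, Z s ω = Function.update a (n + 1) i s} =
      {ω | ∀ s ≤ n, Z s ω = a s} := by
    ext ω
    simp +contextual [hold]
  rw [← hlong, h.transition, hshort, Function.update_self, hold n le_rfl]

theorem ae_ne_zero [Countable S] [IsFiniteMeasure μ] (h : IsMarkovChain P μ Z) :
    ∀ᵐ ω ∂μ, ∀ n, P (Z (n + 1) ω) (Z n ω) ≠ 0 := by
  refine ae_all_iff.2 fun n => ?_
  have hsurj : Function.Surjective fun (a : ℕ → S) (s : Finset.Iic (n + 1)) => a s := fun u =>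
    Subtype.val_injective.surjective_comp_right' (fun _ => u ⟨n, by simp⟩) u
  choose a ha using hsurj
  have hpath (u : Finset.Iic (n + 1) → S) :
      ∀ᵐ ω ∂μ, (∀ s ≤ n + 1, Z s ω = a u s) → P (a u (n + 1)) (a u n) ≠ 0 := by
    by_cases hzero : P (a u (n + 1)) (a u n) = 0
    · have hnull := h.transition (a u) n
      rw [hzero, mul_zero, measureReal_eq_zero_iff] at hnull
      filter_upwards [measure_eq_zero_iff_ae_notMem.1 hnull] with ω hω hvisit
      exact absurd hvisit hω
    · exact ae_of_all _ fun _ _ => hzero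
  filter_upwards [ae_all_iff.2 hpath] with ω hω
  have hext (s : ℕ) (hs : s ≤ n + 1) : a (fun s => Z s ω) s = Z s ω :=
    congrFun (ha fun s => Z s ω) ⟨s, Finset.mem_Iic.2 hs⟩
  rw [← hext n n.le_succ, ← hext (n + 1) le_rfl]
  exact hω _ fun s hs => (hext s hs).symm

end IsMarkovChain

variable [MeasurableSingletonClass S]

theorem stronglyMeasurable_historyFiltration [Finite S] (hZ : ∀ t, Measurable (Z t)) (f : S → ℝ)
    (n : ℕ) : StronglyMeasurable[historyFiltration hZ n] fun ω => f (Z n ω) :=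
  (measurable_of_finite fun u : Finset.Iic n → S => f (u ⟨n, by simp⟩)).stronglyMeasurable
    |>.comp_measurable (comap_measurable fun ω (s : Finset.Iic n) => Z s ω)

theorem integrable_comp_of_finite [Finite S] [IsFiniteMeasure μ] {Y : Ω → S} (hY : Measurable Y)
    (f : S → ℝ) : Integrable (fun ω => f (Y ω)) μ :=
  (Integrable.of_finite (μ := μ.map Y)).comp_measurable hY

namespace IsMarkovChain

variable [Fintype S] [IsFiniteMeasure μ]

theorem condExp_comp_succ (h : IsMarkovChain P μ Z) (f : S → ℝ) (n : ℕ) :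
    μ[fun ω => f (Z (n + 1) ω) | historyFiltration h.measurable n] =ᵐ[μ]
      fun ω => Matrix.vecMul f P (Z n ω) := by
  refine condExp_comap_of_setIntegral_fiber (H := fun ω (s : Finset.Iic n) => Z s ω)
    (φ := fun u => Matrix.vecMul f P (u ⟨n, by simp⟩))
    (measurable_pi_lambda _ fun s => h.measurable s)
    (integrable_comp_of_finite (h.measurable (n + 1)) f) fun u => ?_
  obtain ⟨a, rfl⟩ : ∃ a : ℕ → S, (fun s : Finset.Iic n => a s) = u :=
    Subtype.val_injective.surjective_comp_right' (fun _ => u ⟨n, by simp⟩) u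
  have hcylinder : (fun ω (s : Finset.Iic n) => Z s ω) ⁻¹' {fun s : Finset.Iic n => a s} =
      {ω | ∀ s ≤ n, Z s ω = a s} := by
    ext ω
    simp [funext_iff]
  rw [hcylinder, setIntegral_comp_of_fintype (h.measurable (n + 1)), Matrix.vecMul, dotProduct,
    Finset.mul_sum]
  refine Finset.sum_congr rfl fun i _ => ?_
  rw [h.measureReal_preimage_inter_cylinder]
  ring

theorem isMartingaleDifference (h : IsMarkovChain P μ Z) (f : S → ℝ) :
    IsMartingaleDifference (fun n ω => f (Z (n + 1) ω) - Matrix.vecMul f P (Z n ω))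
      (historyFiltration h.measurable) μ where
  stronglyMeasurable n := (stronglyMeasurable_historyFiltration h.measurable f (n + 1)).sub
    ((stronglyMeasurable_historyFiltration h.measurable _ n).mono
      ((historyFiltration h.measurable).mono n.le_succ))
  integrable n := (integrable_comp_of_finite (h.measurable (n + 1)) f).sub
    (integrable_comp_of_finite (h.measurable n) _)
  condExp_eq_zero n := by
    have hpast := integrable_comp_of_finite (μ := μ) (h.measurable n) (Matrix.vecMul f P)
    refine (condExp_sub (integrable_comp_of_finite (h.measurable (n + 1)) f) hpast _).trans ?_
    rw [condExp_of_stronglyMeasurable _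
      (stronglyMeasurable_historyFiltration h.measurable _ n) hpast]
    filter_upwards [h.condExp_comp_succ f n] with ω hω
    simp [hω]

theorem ae_tendsto_average_sub_vecMul (h : IsMarkovChain P μ Z) (f : S → ℝ) :
    ∀ᵐ ω ∂μ, Tendsto (fun n : ℕ => (n : ℝ)⁻¹ * ∑ k ∈ Finset.range n,
      (f - Matrix.vecMul f P) (Z k ω)) atTop (𝓝 0) := by
  have hmart := (h.isMartingaleDifference f).ae_tendsto_average_of_bounded
    (C := ‖f‖ + ‖Matrix.vecMul f P‖) fun n ω =>
      (abs_sub _ _).trans (add_le_add (norm_le_pi_norm f _) (norm_le_pi_norm (Matrix.vecMul f P) _))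
  filter_upwards [hmart] with ω hω
  have htele := tendsto_average_sub_succ fun n => norm_le_pi_norm f (Z n ω)
  have hsum := htele.add hω
  rw [add_zero] at hsum
  refine hsum.congr fun n => ?_
  rw [← mul_add, ← Finset.sum_add_distrib]
  simp

theorem ae_exists_tendsto_of_vecMul_eq (h : IsMarkovChain P μ Z) {f : S → ℝ}
    (hf : Matrix.vecMul f P = f) :
    ∀ᵐ ω ∂μ, ∃ c, Tendsto (fun n => f (Z n ω)) atTop (𝓝 c) := by
  have hmart : Martingale (fun n ω => f (Z n ω)) (historyFiltration h.measurable) μ :=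
    martingale_nat (stronglyMeasurable_historyFiltration h.measurable f)
      (fun n => integrable_comp_of_finite (h.measurable n) f) fun n => by
        simpa only [hf] using (h.condExp_comp_succ f n).symm
  refine hmart.submartingale.exists_ae_tendsto_of_bdd
    (R := (μ Set.univ).toNNReal * ‖f‖₊) fun n => ?_
  refine (eLpNorm_le_of_ae_bound (C := ‖f‖) (ae_of_all _ fun ω => norm_le_pi_norm f _)).trans ?_
  simp [enorm_eq_nnnorm]

theorem ae_exists_tendsto_average [DecidableEq S] (h : IsMarkovChain P μ Z)
    (hP : P ∈ Matrix.colStochastic ℝ S) (f : S → ℝ) :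
    ∀ᵐ ω ∂μ, ∃ c, Tendsto (fun n : ℕ => (n : ℝ)⁻¹ * ∑ k ∈ Finset.range n, f (Z k ω))
      atTop (𝓝 c) := by
  have horbit (n : ℕ) (g : S → ℝ) : ‖P.vecMulLinear^[n] g‖ ≤ ‖g‖ := by
    induction n with
    | zero => rfl
    | succ n ih =>
      rw [Function.iterate_succ_apply']
      exact (norm_vecMul_le_of_mem_colStochastic hP _).trans ih
  obtain ⟨u, g, hu, rfl⟩ := exists_fixed_add_coboundary (T := P.vecMulLinear)
    (fun g => isBounded_iff_forall_norm_le.2 ⟨‖g‖, Set.forall_mem_range.2 fun n => horbit n g⟩) f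
  filter_upwards [h.ae_exists_tendsto_of_vecMul_eq hu, h.ae_tendsto_average_sub_vecMul g]
    with ω ⟨c, hc⟩ hg
  refine ⟨c + 0, (hc.cesaro.add hg).congr fun n => ?_⟩
  rw [← mul_add, ← Finset.sum_add_distrib]
  simp

theorem ae_exists_tendsto_visitFraction [DecidableEq S] (h : IsMarkovChain P μ Z)
    (hP : P ∈ Matrix.colStochastic ℝ S) :
    ∀ᵐ ω ∂μ, ∃ y ∈ stdSimplex ℝ S,
      (∀ i, Tendsto (visitFraction (fun t => Z t ω) i) atTop (𝓝 (y i))) ∧ P.mulVec y = y := by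
  have hlim : ∀ᵐ ω ∂μ, ∀ i, ∃ c, Tendsto (visitFraction (fun t => Z t ω) i) atTop (𝓝 c) := by
    refine ae_all_iff.2 fun i => ?_
    simpa only [← visitFraction_eq_average] using
      h.ae_exists_tendsto_average hP fun j => if j = i then 1 else 0
  have hstat := ae_all_iff.2 fun i => h.ae_tendsto_average_sub_vecMul (Pi.single i 1)
  filter_upwards [hlim, hstat] with ω hω hstatω
  choose y hy using hω
  refine ⟨y, mem_stdSimplex_of_tendsto_visitFraction hy, hy, funext fun i => ?_⟩
  have hzero := hstatω i
  simp only [average_eq_sum_visitFraction fun t => Z t ω] at hzero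
  have hbalance := tendsto_nhds_unique hzero (tendsto_finsetSum _ fun j _ => (hy j).const_mul _)
  have hexpand : ∑ j, (Pi.single i 1 - Matrix.vecMul (Pi.single i 1) P : S → ℝ) j * y j =
      y i - P.mulVec y i := by
    simp [sub_mul, Finset.sum_sub_distrib, Pi.single_apply, Matrix.mulVec, dotProduct]
  linarith

end IsMarkovChain

end MarkovChain

section Existence

open ProbabilityTheory

variable {S : Type*} [MeasurableSpace S]

theorem trajMeasure_map_zero (μ₀ : Measure S) [IsProbabilityMeasure μ₀]
    (κ : (n : ℕ) → Kernel (Finset.Iic n → S) S) [∀ n, IsMarkovKernel (κ n)] :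
    (Kernel.trajMeasure (X := fun _ => S) μ₀ κ).map (fun u => u 0) = μ₀ := by
  have hinit : (Kernel.trajMeasure (X := fun _ => S) μ₀ κ).map
      (Preorder.frestrictLe (π := fun _ => S) 0) =
      μ₀.map (MeasurableEquiv.piUnique (fun _ : Finset.Iic 0 => S)).symm := by
    rw [Kernel.trajMeasure, Measure.map_comp _ _ (by fun_prop), Kernel.traj_map_frestrictLe,
      Kernel.partialTraj_self, Measure.id_comp]
  have heval : (fun u : ℕ → S => u 0) = (fun v : Finset.Iic 0 → S => v ⟨0, by simp⟩) ∘
      Preorder.frestrictLe (π := fun _ => S) 0 := rfl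
  rw [heval, ← Measure.map_map (by fun_prop) (by fun_prop), hinit,
    Measure.map_map (by fun_prop) (by fun_prop)]
  exact Measure.map_id

theorem trajMeasure_real_cylinder [Countable S] [MeasurableSingletonClass S] (μ₀ : Measure S)
    [IsProbabilityMeasure μ₀] (κ : (n : ℕ) → Kernel (Finset.Iic n → S) S)
    [∀ n, IsMarkovKernel (κ n)] (a : ℕ → S) (n : ℕ) :
    (Kernel.trajMeasure (X := fun _ => S) μ₀ κ).real {u | ∀ s ≤ n + 1, u s = a s} =
      (Kernel.trajMeasure (X := fun _ => S) μ₀ κ).real {u | ∀ s ≤ n, u s = a s} *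
        (κ n fun s => a s).real {a (n + 1)} := by
  have hpast : MeasurableSet {fun s : Finset.Iic n => a s} := measurableSet_singleton _
  have hnext : MeasurableSet {a (n + 1)} := measurableSet_singleton _
  have hcompProd := congrArg (fun ν => ν ({fun s : Finset.Iic n => a s} ×ˢ {a (n + 1)}))
    (Kernel.map_frestrictLe_trajMeasure_compProd_eq_map_trajMeasure
      (X := fun _ => S) (μ₀ := μ₀) (κ := κ) (a := n))
  have hshort : Preorder.frestrictLe (π := fun _ => S) n ⁻¹' {fun s : Finset.Iic n => a s} =
      {u | ∀ s ≤ n, u s = a s} := by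
    ext u
    simp [funext_iff]
  have hlong : (fun u : ℕ → S => (Preorder.frestrictLe (π := fun _ => S) n u, u (n + 1))) ⁻¹'
      ({fun s : Finset.Iic n => a s} ×ˢ {a (n + 1)}) = {u | ∀ s ≤ n + 1, u s = a s} := by
    ext u
    simp [funext_iff, Nat.le_add_one_iff, or_imp, forall_and]
  rw [Measure.compProd_apply_prod hpast hnext, lintegral_singleton,
    Measure.map_apply (by fun_prop) hpast, Measure.map_apply (by fun_prop) (hpast.prod hnext),
    hshort, hlong] at hcompProd
  simp only [measureReal_def, ← ENNReal.toReal_mul]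
  rw [mul_comm, hcompProd]

variable [Fintype S] [MeasurableSingletonClass S]

theorem exists_measure_real_singleton {p : S → ℝ} (hp : p ∈ stdSimplex ℝ S) :
    ∃ ρ : Measure S, IsProbabilityMeasure ρ ∧ ∀ i, ρ.real {i} = p i := by
  have hsum : ∑ i, ENNReal.ofReal (p i) = 1 := by
    rw [← ENNReal.ofReal_sum_of_nonneg fun i _ => hp.1 i, hp.2, ENNReal.ofReal_one]
  refine ⟨(PMF.ofFintype _ hsum).toMeasure, inferInstance, fun i => ?_⟩
  rw [measureReal_def, PMF.toMeasure_apply_singleton _ _ (measurableSet_singleton i),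
    PMF.ofFintype_apply, ENNReal.toReal_ofReal (hp.1 i)]

theorem exists_isMarkovChain [DecidableEq S] {P : Matrix S S ℝ}
    (hP : P ∈ Matrix.colStochastic ℝ S) {p : S → ℝ} (hp : p ∈ stdSimplex ℝ S) :
    ∃ μ : Measure (ℕ → S), IsProbabilityMeasure μ ∧ IsMarkovChain P μ (fun t u => u t) ∧
      ∀ i, μ.real {u | u 0 = i} = p i := by
  obtain ⟨μ₀, hμ₀, hμ₀p⟩ := exists_measure_real_singleton hp
  choose ρ hρ hρP using fun j => exists_measure_real_singleton (p := fun i => P i j)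
    ⟨fun i => Matrix.nonneg_of_mem_colStochastic hP, Matrix.sum_col_of_mem_colStochastic hP j⟩
  let κ (n : ℕ) : Kernel (Finset.Iic n → S) S :=
    ⟨fun u => ρ (u ⟨n, by simp⟩), measurable_of_finite _⟩
  have hκ (n : ℕ) : IsMarkovKernel (κ n) := ⟨fun u => hρ _⟩
  refine ⟨Kernel.trajMeasure (X := fun _ => S) μ₀ κ, inferInstance,
    ⟨measurable_pi_apply, fun a n => ?_⟩, fun i => ?_⟩
  · rw [trajMeasure_real_cylinder, ← hρP]
    rfl
  · rw [← hμ₀p i, ← trajMeasure_map_zero μ₀ κ,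
      map_measureReal_apply (measurable_pi_apply 0) (measurableSet_singleton i),
      trajMeasure_map_zero]
    rfl

end Existence

section Irreducible

variable {S : Type*} [Fintype S] {P : Matrix S S ℝ}

theorem pos_of_isIrreducible_of_mulVec_eq (hP : P.IsIrreducible) {v : S → ℝ} (hv : 0 ≤ v)
    (hfix : P.mulVec v = v) {j : S} (hj : v j ≠ 0) (i : S) : 0 < v i := by
  classical
  obtain ⟨k, -, hk⟩ := (Matrix.isIrreducible_iff_exists_pow_pos hP.nonneg).1 hP i j
  have hpow (k : ℕ) : (P ^ k).mulVec v = v := by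
    induction k with
    | zero => simp
    | succ k ih => rw [pow_succ, ← Matrix.mulVec_mulVec, hfix, ih]
  calc 0 < (P ^ k) i j * v j := mul_pos hk ((hv j).lt_of_ne hj.symm)
    _ ≤ ∑ l, (P ^ k) i l * v l :=
        Finset.single_le_sum (f := fun l => (P ^ k) i l * v l)
          (fun l _ => mul_nonneg (Matrix.pow_apply_nonneg hP.nonneg k i l) (hv l))
          (Finset.mem_univ j)
    _ = v i := congrFun (hpow k) i

theorem eq_of_isIrreducible_of_mulVec_eq (hP : P.IsIrreducible) {x y : S → ℝ}
    (hx : x ∈ stdSimplex ℝ S) (hy : y ∈ stdSimplex ℝ S) (hfx : P.mulVec x = x)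
    (hfy : P.mulVec y = y) : x = y := by
  obtain ⟨j, -, hj⟩ : ∃ j ∈ Finset.univ, y j ≠ 0 :=
    Finset.exists_ne_zero_of_sum_ne_zero (hy.2.trans_ne one_ne_zero)
  have hypos := pos_of_isIrreducible_of_mulVec_eq hP hy.1 hfy hj
  have : Nonempty S := ⟨j⟩
  obtain ⟨i, hi⟩ := Finite.exists_min fun i => x i / y i
  set c := x i / y i
  have hnonneg : 0 ≤ x - c • y := fun l =>
    sub_nonneg.2 ((le_div_iff₀ (hypos l)).1 (hi l))
  have hfix : P.mulVec (x - c • y) = x - c • y := by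
    rw [Matrix.mulVec_sub, Matrix.mulVec_smul, hfx, hfy]
  have hzero : (x - c • y) i = 0 := by
    simp [c, div_mul_cancel₀ _ (hypos i).ne']
  have hprop : x = c • y := by
    refine sub_eq_zero.1 (funext fun l => ?_)
    by_contra hl
    exact (pos_of_isIrreducible_of_mulVec_eq hP hnonneg hfix hl i).ne' hzero
  have hc : c = 1 := by
    have hsum := hx.2
    rw [hprop] at hsum
    simpa [← Finset.mul_sum, hy.2] using hsum
  rw [hprop, hc, one_smul]

end Irreducible

theorem forall_le_pair_eq_iff {S : Type*} {u b : ℕ → S} {m : ℕ} :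
    (∀ s ≤ m, (u (s + 1), u s) = (b (s + 1), b s)) ↔ ∀ s ≤ m + 1, u s = b s := by
  refine ⟨fun h s hs => ?_, fun h s hs => Prod.ext (h _ (by lia)) (h _ (by lia))⟩
  rcases hs.eq_or_lt with rfl | hlt
  · exact congrArg Prod.fst (h m le_rfl)
  · exact congrArg Prod.snd (h s (by lia))

namespace RHOMPModel

variable {N : ℕ}

theorem trans_nonneg (M : RHOMPModel N) (i j k : Fin N) : 0 ≤ M.trans i j k :=
  add_nonneg (mul_nonneg M.α_nonneg (Matrix.nonneg_of_mem_colStochastic M.R_stochastic))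
    (mul_nonneg (sub_nonneg.2 M.α_le_one) (Matrix.nonneg_of_mem_colStochastic M.Q_stochastic))

theorem sum_trans (M : RHOMPModel N) (j k : Fin N) : ∑ i, M.trans i j k = 1 := by
  simp only [trans, Finset.sum_add_distrib, ← Finset.mul_sum]
  rw [Matrix.sum_col_of_mem_colStochastic M.R_stochastic,
    Matrix.sum_col_of_mem_colStochastic M.Q_stochastic]
  ring

/-- The transition matrix of the first-order chain of the pairs `(current state, previous state)`:
from `(j, k)` only pairs `(i, j)` are reached. -/
def pairMatrix (M : RHOMPModel N) : Matrix (Fin N × Fin N) (Fin N × Fin N) ℝ :=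
  Matrix.of fun q p => if q.2 = p.1 then M.trans q.1 p.1 p.2 else 0

theorem pairMatrix_mem_colStochastic (M : RHOMPModel N) :
    M.pairMatrix ∈ Matrix.colStochastic ℝ (Fin N × Fin N) := by
  refine Matrix.mem_colStochastic_iff_sum.2 ⟨fun q p => ?_, fun p => ?_⟩
  · rw [pairMatrix, Matrix.of_apply]
    split_ifs
    exacts [M.trans_nonneg _ _ _, le_rfl]
  · simp [pairMatrix, Fintype.sum_prod_type, sum_trans]

theorem pairMatrix_mulVec_apply (M : RHOMPModel N) (Y : Fin N × Fin N → ℝ) (i j : Fin N) :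
    M.pairMatrix.mulVec Y (i, j) = ∑ k, M.trans i j k * Y (j, k) := by
  simp [pairMatrix, Matrix.mulVec, dotProduct, Fintype.sum_prod_type_right]

variable {M : RHOMPModel N} {Ω : Type*} [MeasurableSpace Ω] {μ : Measure Ω}

theorem IsRHOMP.isMarkovChain_pair {X : ℕ → Ω → Fin N} (h : M.IsRHOMP μ X) :
    IsMarkovChain M.pairMatrix μ fun t ω => (X (t + 1) ω, X t ω) where
  measurable t := (h.measurable (t + 1)).prodMk (h.measurable t)
  transition a n := by
    by_cases hreach : ∃ ω, ∀ s ≤ n, (X (s + 1) ω, X s ω) = a s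
    swap
    · have hshort : {ω | ∀ s ≤ n, (X (s + 1) ω, X s ω) = a s} = ∅ :=
        Set.eq_empty_iff_forall_notMem.2 fun ω hω => hreach ⟨ω, hω⟩
      have hlong : {ω | ∀ s ≤ n + 1, (X (s + 1) ω, X s ω) = a s} = ∅ :=
        Set.eq_empty_iff_forall_notMem.2 fun ω hω => hreach ⟨ω, fun s hs => hω s (by lia)⟩
      simp [hshort, hlong]
    obtain ⟨ω₀, hω₀⟩ := hreach
    by_cases hstep : (a (n + 1)).2 = (a n).1
    swap
    · have hlong : {ω | ∀ s ≤ n + 1, (X (s + 1) ω, X s ω) = a s} = ∅ :=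
        Set.eq_empty_iff_forall_notMem.2 fun ω hω => hstep <| by
          rw [← hω _ le_rfl, ← hω n n.le_succ]
      simp [hlong, pairMatrix, hstep]
    set b := Function.update (fun t => X t ω₀) (n + 2) (a (n + 1)).1 with hb
    have hab : ∀ s ≤ n + 1, a s = (b (s + 1), b s) := by
      intro s hs
      rcases hs.eq_or_lt with rfl | hlt
      · simp [hb, Prod.ext_iff, hstep, ← hω₀ n le_rfl]
      · rw [← hω₀ s (by lia), hb, Function.update_of_ne (by lia), Function.update_of_ne (by lia)]
    have hevent (m : ℕ) (hm : m ≤ n + 1) : {ω | ∀ s ≤ m, (X (s + 1) ω, X s ω) = a s} =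
        {ω | ∀ s ≤ m + 1, X s ω = b s} := by
      ext ω
      refine Iff.trans ?_ forall_le_pair_eq_iff
      exact forall₂_congr fun s hs => by rw [hab s (hs.trans hm)]
    rw [hevent _ le_rfl, hevent n n.le_succ, h.transition, hab n n.le_succ, hab _ le_rfl]
    simp [pairMatrix]

theorem ae_eq_pair_of_isMarkovChain [IsFiniteMeasure μ] {Z : ℕ → Ω → Fin N × Fin N}
    (h : IsMarkovChain M.pairMatrix μ Z) : ∀ᵐ ω ∂μ, ∀ t, Z t ω = ((Z (t + 1) ω).2, (Z t ω).2) := by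
  filter_upwards [h.ae_ne_zero] with ω hω t
  have hreached : (Z (t + 1) ω).2 = (Z t ω).1 := by
    by_contra hne
    exact hω t (if_neg hne)
  rw [hreached]

theorem isRHOMP_snd [IsFiniteMeasure μ] {Z : ℕ → Ω → Fin N × Fin N}
    (h : IsMarkovChain M.pairMatrix μ Z) : M.IsRHOMP μ fun t ω => (Z t ω).2 where
  measurable t := measurable_snd.comp (h.measurable t)
  transition a n := by
    have hevent (m : ℕ) : μ.real {ω | ∀ s ≤ m + 1, (Z s ω).2 = a s} =
        μ.real {ω | ∀ s ≤ m, Z s ω = (a (s + 1), a s)} := by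
      refine measureReal_congr ?_
      filter_upwards [ae_eq_pair_of_isMarkovChain h] with ω hω
      refine propext (forall_le_pair_eq_iff.symm.trans ?_)
      exact forall₂_congr fun s _ => by rw [← hω s]
    rw [hevent, hevent, h.transition fun s => (a (s + 1), a s)]
    simp [pairMatrix]

theorem exists_isRHOMP (M : RHOMPModel N) {p : Fin N × Fin N → ℝ}
    (hp : p ∈ stdSimplex ℝ (Fin N × Fin N)) :
    ∃ (Ω : Type) (_ : MeasurableSpace Ω) (μ : Measure Ω) (_ : IsProbabilityMeasure μ)
      (X : ℕ → Ω → Fin N),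
      M.IsRHOMP μ X ∧ ∀ j k : Fin N, μ.real {ω | X 1 ω = j ∧ X 0 ω = k} = p (j, k) := by
  obtain ⟨μ, hμ, hchain, hinit⟩ := exists_isMarkovChain M.pairMatrix_mem_colStochastic hp
  refine ⟨_, _, μ, hμ, _, isRHOMP_snd hchain, fun j k => ?_⟩
  rw [← hinit]
  refine measureReal_congr ?_
  filter_upwards [ae_eq_pair_of_isMarkovChain hchain] with u hu
  exact propext (Prod.mk_inj.symm.trans (by rw [← hu 0]; rfl))

theorem eq_mix_mulVec_of_stationary {Y : Fin N × Fin N → ℝ} {x : Fin N → ℝ}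
    (hY : ∀ i j, Y (i, j) = ∑ k, M.trans i j k * Y (j, k))
    (hfst : ∀ i, x i = ∑ j, Y (i, j)) (hsnd : ∀ i, x i = ∑ j, Y (j, i)) :
    x = M.mix.mulVec x := by
  ext i
  calc x i = ∑ j, ∑ k, (M.α * M.R i j + (1 - M.α) * M.Q i k) * Y (j, k) := by
        simp_rw [hfst i, hY i, trans]
    _ = ∑ j, M.α * M.R i j * ∑ k, Y (j, k) + ∑ k, (1 - M.α) * M.Q i k * ∑ j, Y (j, k) := by
        simp_rw [add_mul, Finset.sum_add_distrib, Finset.mul_sum]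
        rw [Finset.sum_comm (f := fun j k => (1 - M.α) * M.Q i k * Y (j, k))]
    _ = M.mix.mulVec x i := by
        simp_rw [← hfst, ← hsnd, ← Finset.sum_add_distrib, ← add_mul]
        rfl

theorem IsRHOMP.ae_exists_limits [IsFiniteMeasure μ] {X : ℕ → Ω → Fin N} (h : M.IsRHOMP μ X) :
    ∀ᵐ ω ∂μ, ∃ Y ∈ stdSimplex ℝ (Fin N × Fin N), ∃ x ∈ stdSimplex ℝ (Fin N),
      (∀ j k, Tendsto (visitFraction (fun t => (X (t + 1) ω, X t ω)) (j, k)) atTop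
        (𝓝 (Y (j, k)))) ∧
      (∀ i, Tendsto (visitFraction (fun t => X t ω) i) atTop (𝓝 (x i))) ∧
      (∀ i j, Y (i, j) = ∑ k, M.trans i j k * Y (j, k)) ∧
      (∀ i, x i = ∑ j, Y (i, j)) ∧
      (∀ i, x i = ∑ j, Y (j, i)) ∧
      x = M.mix.mulVec x := by
  filter_upwards [h.isMarkovChain_pair.ae_exists_tendsto_visitFraction
    M.pairMatrix_mem_colStochastic] with ω ⟨Y, hYmem, hY, hfix⟩
  have hcurrent (i : Fin N) :
      Tendsto (visitFraction (fun t => X (t + 1) ω) i) atTop (𝓝 (∑ j, Y (i, j))) :=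
    (tendsto_finsetSum _ fun j _ => hY (i, j)).congr fun t =>
      (visitFraction_fst_eq_sum (fun t => (X (t + 1) ω, X t ω)) i t).symm
  have hprevious (i : Fin N) :
      Tendsto (visitFraction (fun t => X t ω) i) atTop (𝓝 (∑ j, Y (j, i))) :=
    (tendsto_finsetSum _ fun j _ => hY (j, i)).congr fun t =>
      (visitFraction_snd_eq_sum (fun t => (X (t + 1) ω, X t ω)) i t).symm
  have hmarginals (i : Fin N) : ∑ j, Y (j, i) = ∑ j, Y (i, j) :=
    sub_eq_zero.1 (tendsto_nhds_unique ((hprevious i).sub (hcurrent i))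
      (tendsto_visitFraction_sub_shift (fun t => X t ω) i))
  have hstat (i j : Fin N) : Y (i, j) = ∑ k, M.trans i j k * Y (j, k) := by
    rw [← pairMatrix_mulVec_apply, hfix]
  exact ⟨Y, hYmem, fun i => ∑ j, Y (j, i), mem_stdSimplex_of_tendsto_visitFraction hprevious,
    fun j k => hY (j, k), hprevious, hstat, hmarginals, fun _ => rfl,
    eq_mix_mulVec_of_stationary hstat hmarginals fun _ => rfl⟩

end RHOMPModel

theorem theorem1 {N : ℕ} (hN : 0 < N) (M : RHOMPModel N) :
    -- from every initial law of the first two states there is such a process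
    (∀ p ∈ stdSimplex ℝ (Fin N × Fin N),
      ∃ (Ω : Type) (_ : MeasurableSpace Ω) (μ : Measure Ω) (_ : IsProbabilityMeasure μ)
        (X : ℕ → Ω → Fin N),
        M.IsRHOMP μ X ∧ ∀ j k : Fin N, μ.real {ω | X 1 ω = j ∧ X 0 ω = k} = p (j, k)) ∧
    -- almost surely the limiting distributions `Y` of the (current, previous) pair and `x` of the
    -- state exist, `Y` is stationary for the chain of pairs, both marginals of `Y` are `x`,
    -- and `x = (αR + (1 - α)Q) x`
    (∀ (Ω : Type*) [MeasurableSpace Ω] (μ : Measure Ω) [IsProbabilityMeasure μ]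
        (X : ℕ → Ω → Fin N), M.IsRHOMP μ X →
      ∀ᵐ ω ∂μ, ∃ Y ∈ stdSimplex ℝ (Fin N × Fin N), ∃ x ∈ stdSimplex ℝ (Fin N),
        (∀ j k, Tendsto (visitFraction (fun t => (X (t + 1) ω, X t ω)) (j, k)) atTop
          (𝓝 (Y (j, k)))) ∧
        (∀ i, Tendsto (visitFraction (fun t => X t ω) i) atTop (𝓝 (x i))) ∧
        (∀ i j, Y (i, j) = ∑ k, M.trans i j k * Y (j, k)) ∧
        (∀ i, x i = ∑ j, Y (i, j)) ∧
        (∀ i, x i = ∑ j, Y (j, i)) ∧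
        x = M.mix.mulVec x) ∧
    -- if `αR + (1 - α)Q` is irreducible, then the limiting distribution is unique: it is one and
    -- the same for all processes with these parameters and almost all of their trajectories,
    -- and it is the only distribution with `x = (αR + (1 - α)Q) x`
    (M.mix.IsIrreducible →
      ∃ x ∈ stdSimplex ℝ (Fin N),
        x = M.mix.mulVec x ∧
        (∀ y ∈ stdSimplex ℝ (Fin N), y = M.mix.mulVec y → y = x) ∧
        ∀ (Ω : Type*) [MeasurableSpace Ω] (μ : Measure Ω) [IsProbabilityMeasure μ]
          (X : ℕ → Ω → Fin N), M.IsRHOMP μ X →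
          ∀ᵐ ω ∂μ, ∀ i, Tendsto (visitFraction (fun t => X t ω) i) atTop (𝓝 (x i))) := by
  refine ⟨fun p hp => M.exists_isRHOMP hp, fun Ω _ μ _ X h => h.ae_exists_limits,
    fun hirr => ?_⟩
  obtain ⟨x, hx, hfix⟩ : ∃ x ∈ stdSimplex ℝ (Fin N), x = M.mix.mulVec x := by
    obtain ⟨Ω, _, μ, _, X, h, -⟩ := M.exists_isRHOMP
      (single_mem_stdSimplex ℝ ((⟨0, hN⟩, ⟨0, hN⟩) : Fin N × Fin N))
    obtain ⟨ω, _, -, x, hx, -, -, -, -, -, hfix⟩ := h.ae_exists_limits.exists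
    exact ⟨x, hx, hfix⟩
  have hunique (y) (hy : y ∈ stdSimplex ℝ (Fin N)) (hfy : y = M.mix.mulVec y) : y = x :=
    eq_of_isIrreducible_of_mulVec_eq hirr hy hx hfy.symm hfix.symm
  refine ⟨x, hx, hfix, hunique, fun Ω _ μ _ X h => ?_⟩
  filter_upwards [h.ae_exists_limits] with ω ⟨_, _, y, hy, _, hlim, _, _, _, hfy⟩
  rw [← hunique y hy hfy]
  exact hlim
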